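/- Let $p$ be a prime. A cyclotomic pro-$p$ pair $\mathcal G=(G,\theta)$ consists of a pro-$p$ group $G$ and a continuous homomorphism $\theta\colon G\to\mathbb{Z}_p^\times$; it is called torsion-free if the image of $\theta$ is torsion-free. Let $\mathbb{Z}_p(1)$ denote the $G$-module $\mathbb{Z}_p$ with the action $g\cdot z=\theta(g)z$. The pair $\mathcal G$ is called Kummerian if for every $n\ge 1$ the map $$H^1(G,\mathbb{Z}_p(1)/p^n)\longrightarrow H^1(G,\mathbb{Z}_p(1)/p)$$ in continuous cohomology induced by the reduction $\mathbb{Z}_p(1)/p^n\to\mathbb{Z}_p(1)/p$ is surjective. Theorem 6.6. Let $\mathcal G=(G,\theta)$ be a torsion-free Kummerian cyclotomic pro-$p$ pair and let $N\subseteq\operatorname{Ker}(\theta)$ be a closed normal subgroup of $G$ such that $G/N$ is (topologically) finitely generated and the restriction map $$\operatorname{res}^1_{G,N}\colon H^1(G,\mathbb{Z}/p)\longrightarrow H^1(N,\mathbb{Z}/p)^G$$ is surjective, where $\mathbb{Z}/p$ carries the trivial action and $G$ acts on $H^1(N,\mathbb{Z}/p)$ through conjugation on $N$. Then $\mathcal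 G/N=(G/N,\bar\theta)$, where $\bar\theta\colon G/N\to\mathbb{Z}_p^\times$ is the orientation induced by $\theta$, is again a Kummerian cyclotomic pro-$p$ pair. -/

import Mathlib

open CategoryTheory

universe u

noncomputable section

namespace ProPPair

/-- `G` is a pro-`p` group: a profinite group all of whose finite continuous quotients are
`p`-groups. (A totally disconnected topological group is automatically Hausdorff.) -/
structure IsProP (p : ℕ) (G : Type u) [Group G] [TopologicalSpace G] [IsTopologicalGroup G] :
    Prop where
  compact : CompactSpace G
  totallyDisconnected : TotallyDisconnectedSpace G
  index_eq : ∀ U : Subgroup G, U.Normal → IsOpen (U : Set G) → ∃ k : ℕ, U.index = p ^ k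

/-- `G` is finitely generated as a topological group: some finite subset generates a dense
subgroup. -/
def IsTopologicallyFG (G : Type u) [Group G] [TopologicalSpace G] [IsTopologicalGroup G] : Prop :=
  ∃ S : Set G, S.Finite ∧ (Subgroup.closure S).topologicalClosure = ⊤

section Orientation

variable {p : ℕ} [Fact p.Prime] {G : Type u} [Group G] [TopologicalSpace G] [IsTopologicalGroup G]

/-- The orientation `θ : G → ℤ_pˣ` has torsion-free image. -/
def IsTorsionFree (θ : G →ₜ* ℤ_[p]ˣ) : Prop :=
  IsMulTorsionFree (θ : G →* ℤ_[p]ˣ).range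

/-- The orientation of `G ⧸ N` induced by an orientation `θ` of `G`, where `N ≤ ker θ`. -/
def quotientOrientation (θ : G →ₜ* ℤ_[p]ˣ) (N : Subgroup G) [N.Normal]
    (hN : N ≤ (θ : G →* ℤ_[p]ˣ).ker) : G ⧸ N →ₜ* ℤ_[p]ˣ where
  toMonoidHom := QuotientGroup.lift N (θ : G →* ℤ_[p]ˣ) hN
  continuous_toFun := θ.continuous_toFun.quotient_lift _

/-- The discrete `G`-module `ℤ_p(1)/p^n`: the group `ℤ/p^n = ℤ_p/p^n` (lifted to the universe
of `G`), on which `g` acts as multiplication by `θ(g) mod p^n`. -/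
def tateModule (θ : G →ₜ* ℤ_[p]ˣ) (n : ℕ) : TopRep.{u} ℤ G :=
  TopRep.of (X := ULift.{u} (ZMod (p ^ n))) <| .ofMonoidHom
    { toFun := fun g =>
        { toFun := fun x => ULift.up (PadicInt.toZModPow n (θ g : ℤ_[p]) * x.down)
          map_add' := fun x y => by ext; simp [mul_add]
          map_smul' := fun m x => by ext; simp [mul_left_comm]
          cont := continuous_of_discreteTopology }
      map_one' := by ext x; simp
      map_mul' := fun g h => by ext x; simp [mul_assoc] }

/-- The reduction map of `G`-modules `ℤ_p(1)/p^n → ℤ_p(1)/p`, for `n ≥ 1`. -/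
def tateReduction (θ : G →ₜ* ℤ_[p]ˣ) {n : ℕ} (hn : 1 ≤ n) : tateModule θ n ⟶ tateModule θ 1 :=
  TopRep.ofHom
    { toFun := fun x => ULift.up (ZMod.castHom (pow_dvd_pow p hn) (ZMod (p ^ 1)) x.down)
      map_add' := fun x y => by
        ext
        exact map_add (ZMod.castHom (pow_dvd_pow p hn) (ZMod (p ^ 1))) x.down y.down
      map_smul' := fun m x => by
        ext
        exact map_zsmul (ZMod.castHom (pow_dvd_pow p hn) (ZMod (p ^ 1))) m x.down
      cont := continuous_of_discreteTopology
      isIntertwining' := fun g => by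
        ext x
        have h := RingHom.congr_fun (PadicInt.zmod_cast_comp_toZModPow (p := p) 1 n hn)
          (θ g : ℤ_[p])
        change ZMod.castHom (pow_dvd_pow p hn) (ZMod (p ^ 1))
            (PadicInt.toZModPow n (θ g : ℤ_[p]) * x.down) =
          PadicInt.toZModPow 1 (θ g : ℤ_[p]) *
            ZMod.castHom (pow_dvd_pow p hn) (ZMod (p ^ 1)) x.down
        rw [map_mul, ← h]
        rfl }

/-- `(G, θ)` is Kummerian: for every `n ≥ 1` the map
`H¹(G, ℤ_p(1)/p^n) → H¹(G, ℤ_p(1)/p)` induced by reduction is surjective. -/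
def IsKummerian (θ : G →ₜ* ℤ_[p]ˣ) : Prop :=
  ∀ (n : ℕ) (hn : 1 ≤ n), Function.Surjective
    (ContinuousCohomology.map (G := G) (H := G) (X := tateModule.{u} θ n) (Y := tateModule.{u} θ 1)
      (ContinuousMonoidHom.id G) (tateReduction θ hn) 1)

end Orientation

section Restriction

variable (p : ℕ) {G : Type u} [Group G] [TopologicalSpace G] [IsTopologicalGroup G]

variable (G) in
/-- The discrete `G`-module `ℤ/p` (lifted to the universe of `G`) with trivial action. -/
def trivialModule : TopRep.{u} ℤ G :=
  TopRep.of (ContRepresentation.trivial ℤ G (ULift.{u} (ZMod p)))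

/-- For a continuous homomorphism `φ : H → G`, the identity of `ℤ/p` as a map from the
restriction along `φ` of the trivial `G`-module to the trivial `H`-module. -/
def trivialModuleMap {H : Type u} [Group H] [TopologicalSpace H] [IsTopologicalGroup H]
    (φ : H →ₜ* G) : TopRep.res (φ : H →* G) (trivialModule p G) ⟶ trivialModule p H :=
  TopRep.ofHom
    { toContinuousLinearMap := ContinuousLinearMap.id ℤ (ULift.{u} (ZMod p))
      isIntertwining' := fun _ => rfl }

/-- The inclusion `N → G` as a continuous homomorphism. -/
def inclusion (N : Subgroup G) : N →ₜ* G where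
  toMonoidHom := N.subtype
  continuous_toFun := continuous_subtype_val

/-- For `N` normal in `G` and `g : G`, the continuous homomorphism `N → N`, `x ↦ g⁻¹ x g`. -/
def conj (N : Subgroup G) [N.Normal] (g : G) : N →ₜ* N where
  toMonoidHom := (MulAut.conjNormal g⁻¹ : MulAut N).toMonoidHom
  continuous_toFun := Continuous.subtype_mk
    (((continuous_const (y := g⁻¹)).mul continuous_subtype_val).mul
      (continuous_const (y := g⁻¹⁻¹))) _

/-- The restriction map `H¹(G, ℤ/p) → H¹(N, ℤ/p)`. -/
def restriction (N : Subgroup G) :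
    continuousCohomology 1 (trivialModule p G) ⟶ continuousCohomology 1 (trivialModule p N) :=
  ContinuousCohomology.map (inclusion N) (trivialModuleMap p (inclusion N)) 1

/-- The action of `g : G` on `H¹(N, ℤ/p)` for `N` normal in `G`, given on cocycles by
`(g • c)(x) = c(g⁻¹ x g)`. -/
def conjAction (N : Subgroup G) [N.Normal] (g : G) :
    continuousCohomology 1 (trivialModule p N) ⟶ continuousCohomology 1 (trivialModule p N) :=
  ContinuousCohomology.map (conj N g) (trivialModuleMap p (conj N g)) 1

/-- The `G`-invariants `H¹(N, ℤ/p)^G`, for `N` normal in `G`. -/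
def invariantClasses (N : Subgroup G) [N.Normal] :
    Set (continuousCohomology 1 (trivialModule p N)) :=
  {y | ∀ g : G, conjAction p N g y = y}

end Restriction

end ProPPair

end

/-! A pro-`p` group acts trivially on `ℤ_p(1)/p` (`toZModPow_one_orientation`), so mod `p` there are
no nonzero coboundaries and `H¹` is the group of continuous homomorphisms. Kummerian thus means that
every homomorphism `G → ℤ/p` lifts to a cocycle mod `p^n` (`LiftsHoms`).

Given `α` on `G ⧸ N`, lift its inflation to a cocycle `c` on `G`. Since `θ = 1` on `N`, `c` is a
homomorphism there, with values divisible by `p`. If they are divisible by `p^k`, `1 ≤ k < n`, then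
`c/p^k` mod `p` is a homomorphism `N → ℤ/p`, invariant because conjugation scales `c` by a unit
congruent to `1`. Surjectivity of restriction extends it to `β` on `G`
(`exists_extension_of_surjOn`); with `d` a lift of `β`, the cocycle `c - p^k d` is the same mod `p`
and divisible by `p^(k+1)` on `N` (`exists_divisible_succ`). At `k = n` the cocycle vanishes on `N`
and descends to `G ⧸ N`. -/

noncomputable section

/-! ### Kernels and cokernels of topological modules, elementwise. -/

namespace TopModuleCat

variable {R : Type*} [Ring R] [TopologicalSpace R]

/-- The map to the vertex of any cokernel cofork in `TopModuleCat R` is surjective. -/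
lemma surjective_of_isColimit_cokernelCofork {M N Q : TopModuleCat R} (f : M ⟶ N) (q : N ⟶ Q)
    (w : f ≫ q = 0) (h : Limits.IsColimit (Limits.CokernelCofork.ofπ q w)) :
    Function.Surjective q := by
  let e := h.coconePointUniqueUpToIso (isColimitCoker f)
  have he : q ≫ e.hom = cokerπ f :=
    h.comp_coconePointUniqueUpToIso_hom (isColimitCoker f) Limits.WalkingParallelPair.one
  intro y
  obtain ⟨x, hx⟩ := cokerπ_surjective f (e.hom y)
  refine ⟨x, ?_⟩
  exact (ConcreteCategory.bijective_of_isIso e.hom).1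
    ((ConcreteCategory.congr_hom he x).trans hx)

/-- The kernel of a cokernel map in `TopModuleCat R` is the range of the original map. -/
lemma exists_of_isColimit_cokernelCofork {M N Q : TopModuleCat R} (f : M ⟶ N) (q : N ⟶ Q)
    (w : f ≫ q = 0) (h : Limits.IsColimit (Limits.CokernelCofork.ofπ q w)) {x : N}
    (hx : q x = 0) : ∃ m, f m = x := by
  let e := h.coconePointUniqueUpToIso (isColimitCoker f)
  have he : q ≫ e.hom = cokerπ f :=
    h.comp_coconePointUniqueUpToIso_hom (isColimitCoker f) Limits.WalkingParallelPair.one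
  have h1 : cokerπ f x = 0 := by
    rw [← he, ConcreteCategory.comp_apply, hx, map_zero]
  exact (Submodule.Quotient.mk_eq_zero _).1 h1

/-- The map from the vertex of any kernel fork in `TopModuleCat R` is injective. -/
lemma injective_of_isLimit_kernelFork {K M N : TopModuleCat R} (f : M ⟶ N) (i : K ⟶ M)
    (w : i ≫ f = 0) (h : Limits.IsLimit (Limits.KernelFork.ofι i w)) :
    Function.Injective i := by
  let e := h.conePointUniqueUpToIso (isLimitKer f)
  have he : e.hom ≫ kerι f = i :=
    h.conePointUniqueUpToIso_hom_comp (isLimitKer f) Limits.WalkingParallelPair.zero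
  intro x y hxy
  apply (ConcreteCategory.bijective_of_isIso e.hom).1
  apply Subtype.ext
  have : (e.hom ≫ kerι f) x = (e.hom ≫ kerι f) y := by rw [he, hxy]
  exact this

/-- The range of a kernel map in `TopModuleCat R` is the kernel of the original map. -/
lemma exists_of_isLimit_kernelFork {K M N : TopModuleCat R} (f : M ⟶ N) (i : K ⟶ M)
    (w : i ≫ f = 0) (h : Limits.IsLimit (Limits.KernelFork.ofι i w)) {x : M} (hx : f x = 0) :
    ∃ z, i z = x := by
  let e := h.conePointUniqueUpToIso (isLimitKer f)
  have he : e.inv ≫ i = kerι f :=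
    h.conePointUniqueUpToIso_inv_comp (isLimitKer f) Limits.WalkingParallelPair.zero
  refine ⟨e.inv (⟨x, hx⟩ : f.hom.ker), ?_⟩
  rw [← ConcreteCategory.comp_apply, he]
  rfl

end TopModuleCat

/-! ### Degree-one classes as inhomogeneous cocycles modulo coboundaries. -/

namespace ContinuousCohomology

open TopRep ContRepresentation

section

variable {k G : Type*} [Ring k] [TopologicalSpace k]
  [Group G] [TopologicalSpace G] [IsTopologicalGroup G]

/-- Inhomogeneous continuous `1`-cocycles. -/
def IsOneCocycle (X : TopRep k G) (c : C(G, X)) : Prop :=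
  ∀ g h, c (g * h) = c g + X.ρ g (c h)

/-- The value of a homogeneous `1`-cochain. -/
def evalOneCochain (X : TopRep k G) (σ : (homogeneousCochains X).X 1) (x y : G) : X :=
  (show C(G, C(G, X)) from σ.1) x y

/-- The inhomogeneous cocycle `c` represents the class `y`. -/
def Represents (X : TopRep k G) (c : C(G, X)) (y : continuousCohomology 1 X) : Prop :=
  ∃ z : cocycles X 1, (∀ g, evalOneCochain X ((homogeneousCochains X).iCycles 1 z) 1 g = c g) ∧
    π X 1 z = y

variable {X : TopRep k G}

lemma evalOneCochain_invariant (σ : (homogeneousCochains X).X 1) (g x y : G) :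
    X.ρ g (evalOneCochain X σ (g⁻¹ * x) (g⁻¹ * y)) = evalOneCochain X σ x y :=
  DFunLike.congr_fun (DFunLike.congr_fun (σ.2 g) x) y

lemma d_one_apply (σ : (homogeneousCochains X).X 1) (x y z : G) :
    (show C(G, C(G, C(G, X))) from ((homogeneousCochains X).d 1 2 σ).1) x y z =
      evalOneCochain X σ y z - (evalOneCochain X σ x z - evalOneCochain X σ x y) := by
  have h := homogeneousCochains.d_apply X 1 σ
  have h' := congrArg (fun t : C(G, C(G, C(G, X))) => t x y z) h
  exact h'

lemma d_zero_apply (τ : (homogeneousCochains X).X 0) (x y : G) :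
    evalOneCochain X ((homogeneousCochains X).d 0 1 τ) x y =
      (show C(G, X) from τ.1) y - (show C(G, X) from τ.1) x := by
  have h := homogeneousCochains.d_apply X 0 τ
  have h' := congrArg (fun t : C(G, C(G, X)) => t x y) h
  exact h'

lemma evalOneCochain_cocycle (z : cocycles X 1) (x y w : G) :
    evalOneCochain X ((homogeneousCochains X).iCycles 1 z) x w =
      evalOneCochain X ((homogeneousCochains X).iCycles 1 z) x y +
      evalOneCochain X ((homogeneousCochains X).iCycles 1 z) y w := by
  have h0 : (homogeneousCochains X).d 1 2 ((homogeneousCochains X).iCycles 1 z) = 0 := by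
    rw [← ConcreteCategory.comp_apply, HomologicalComplex.iCycles_d]; rfl
  have h := d_one_apply ((homogeneousCochains X).iCycles 1 z) x y w
  rw [h0] at h
  change (0 : X) = _ at h
  rw [eq_comm, sub_eq_zero] at h
  rw [h]; abel

/-- For a homogeneous cocycle, `σ(1, gk) = σ(1, g) + σ(g, gk)`, and invariance turns the last term
into `g • σ(1, k)`. -/
lemma Represents.isOneCocycle {c : C(G, X)} {y : continuousCohomology 1 X}
    (h : Represents X c y) : IsOneCocycle X c := by
  obtain ⟨z, hz, -⟩ := h
  intro g k
  rw [← hz, ← hz, ← hz, evalOneCochain_cocycle z 1 g (g * k),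
    ← evalOneCochain_invariant _ g g (g * k)]
  simp

lemma exists_represents (y : continuousCohomology 1 X) : ∃ c, Represents X c y := by
  obtain ⟨z, hz⟩ := TopModuleCat.surjective_of_isColimit_cokernelCofork _ _ _
    ((homogeneousCochains X).homologyIsCokernel 0 1 (by simp)) y
  exact ⟨(show C(G, C(G, X)) from ((homogeneousCochains X).iCycles 1 z).1) 1, z, fun _ => rfl, hz⟩

/-- The homogeneous cochain `(x, y) ↦ c y - c x`. -/
def oneCochainOfCocycle (c : C(G, X)) (hc : IsOneCocycle X c) : (homogeneousCochains X).X 1 :=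
  ⟨(show C(G, C(G, X)) from
      ⟨fun x => c - ContinuousMap.const G (c x),
        continuous_const.sub (ContinuousMap.continuous_const'.comp c.continuous)⟩), by
    intro g
    refine ContinuousMap.ext fun x => ContinuousMap.ext fun y => ?_
    change X.ρ g (c (g⁻¹ * y) - c (g⁻¹ * x)) = c y - c x
    rw [hc, hc, add_sub_add_left_eq_sub, ← map_sub, ← mul_apply_eq_comp, ← map_mul]
    simp⟩

lemma exists_class {c : C(G, X)} (hc : IsOneCocycle X c) : ∃ y, Represents X c y := by
  have h0 : (homogeneousCochains X).d 1 2 (oneCochainOfCocycle c hc) = 0 := by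
    apply Subtype.ext
    refine ContinuousMap.ext fun x => ContinuousMap.ext fun y => ContinuousMap.ext fun z => ?_
    refine (d_one_apply _ x y z).trans ?_
    change (c z - c y) - ((c z - c x) - (c y - c x)) = 0
    abel
  obtain ⟨z, hz⟩ := TopModuleCat.exists_of_isLimit_kernelFork _ _ _
    ((homogeneousCochains X).cyclesIsKernel 1 2 (by simp)) h0
  refine ⟨π X 1 z, z, fun g => ?_, rfl⟩
  erw [hz]
  change c g - c 1 = c g
  have h1 : c 1 = 0 := by simpa using hc 1 1
  rw [h1, sub_zero]

/-- An invariant cochain is determined by its values `σ(1, ·)`, as `σ(x, y) = x • σ(1, x⁻¹y)`. -/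
lemma Represents.unique {c : C(G, X)} {y y' : continuousCohomology 1 X}
    (h : Represents X c y) (h' : Represents X c y') : y = y' := by
  obtain ⟨z, hz, rfl⟩ := h
  obtain ⟨z', hz', rfl⟩ := h'
  congr 1
  apply TopModuleCat.injective_of_isLimit_kernelFork _ _ _
    ((homogeneousCochains X).cyclesIsKernel 1 2 (by simp))
  apply Subtype.ext
  refine ContinuousMap.ext fun x => ContinuousMap.ext fun y => ?_
  change evalOneCochain X ((homogeneousCochains X).iCycles 1 z) x y =
    evalOneCochain X ((homogeneousCochains X).iCycles 1 z') x y
  rw [← evalOneCochain_invariant _ x,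
    ← evalOneCochain_invariant (_ : (homogeneousCochains X).X 1) x x y]
  simp [hz, hz']

lemma Represents.exists_coboundary {c c' : C(G, X)} {y : continuousCohomology 1 X}
    (h : Represents X c y) (h' : Represents X c' y) :
    ∃ v : X, ∀ g, c g - c' g = X.ρ g v - v := by
  obtain ⟨z, hz, hy⟩ := h
  obtain ⟨z', hz', hy'⟩ := h'
  have h0 : π X 1 (z - z') = 0 := by rw [map_sub, hy, hy', sub_self]
  obtain ⟨τ, hτ⟩ := TopModuleCat.exists_of_isColimit_cokernelCofork _ _ _
    ((homogeneousCochains X).homologyIsCokernel 0 1 (by simp)) h0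
  -- Invariance gives `τ(g) = g • τ(1)`, so `v = τ(1)`.
  refine ⟨(show C(G, X) from τ.1) 1, fun g => ?_⟩
  have h1 : (homogeneousCochains X).d 0 1 τ = (homogeneousCochains X).iCycles 1 z -
      (homogeneousCochains X).iCycles 1 z' := by
    rw [← map_sub, ← hτ, ← ConcreteCategory.comp_apply, HomologicalComplex.toCycles_i]
  have h2 := d_zero_apply τ 1 g
  rw [h1] at h2
  have h3 : X.ρ g ((show C(G, X) from τ.1) (g⁻¹ * g)) = (show C(G, X) from τ.1) g :=
    DFunLike.congr_fun (τ.2 g) g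
  rw [inv_mul_cancel] at h3
  rw [h3, ← h2, ← hz, ← hz']
  rfl

end

variable {k : Type*} {G H : Type u} [Ring k] [TopologicalSpace k]
  [Group G] [TopologicalSpace G] [IsTopologicalGroup G]
  [Group H] [TopologicalSpace H] [IsTopologicalGroup H]
  {X : TopRep k G} {Y : TopRep k H}

lemma Represents.map (φ : H →ₜ* G) (f : res (φ : H →* G) X ⟶ Y) {c : C(G, X)}
    {y : continuousCohomology 1 X} (h : Represents X c y) {c' : C(H, Y)}
    (hc' : ∀ x, c' x = f.hom (c (φ x))) :
    Represents Y c' (ContinuousCohomology.map φ f 1 y) := by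
  obtain ⟨z, hz, rfl⟩ := h
  refine ⟨cocyclesMap φ f 1 z, fun g => ?_, ?_⟩
  · rw [hc', ← hz]
    have : (homogeneousCochains Y).iCycles 1 (cocyclesMap φ f 1 z) =
        (cochainsMap φ f).f 1 ((homogeneousCochains X).iCycles 1 z) := by
      rw [← ConcreteCategory.comp_apply, ← ConcreteCategory.comp_apply,
        HomologicalComplex.cyclesMap_i]
    rw [this, ← map_one φ]
    rfl
  · rw [← ConcreteCategory.comp_apply, ← ConcreteCategory.comp_apply, π_map]

end ContinuousCohomology

namespace ProPPair

/-! ### Quotients of pro-`p` groups. -/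

section Quotient

lemma IsProP.quotient {p : ℕ} {G : Type u} [Group G] [TopologicalSpace G] [IsTopologicalGroup G]
    (hG : IsProP p G) (N : Subgroup G) [N.Normal] (hN : IsClosed (N : Set G)) :
    IsProP p (G ⧸ N) where
  compact := have := hG.compact; inferInstance
  totallyDisconnected := by
    have := hG.compact
    have := hG.totallyDisconnected
    rw [totallyDisconnectedSpace_iff_connectedComponent_one]
    refine Set.eq_singleton_iff_unique_mem.2 ⟨mem_connectedComponent, fun x hx => ?_⟩
    obtain ⟨g, rfl⟩ := QuotientGroup.mk_surjective x
    rw [QuotientGroup.eq_one_iff]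
    -- `N` is the intersection of the open subgroups containing it; each has clopen image in `G ⧸
    -- N`, which traps the component of `1`.
    have h := ProfiniteGrp.closedSubgroup_eq_sInf_open (⟨N, hN⟩ : ClosedSubgroup G)
    change N = _ at h
    rw [h, Subgroup.mem_sInf]
    rintro U ⟨hU, hNU⟩
    have hUo : IsOpen (U.map (QuotientGroup.mk' N) : Set (G ⧸ N)) :=
      QuotientGroup.isOpenMap_coe _ hU
    have hmem := IsClopen.connectedComponent_subset
      (⟨Subgroup.isClosed_of_isOpen _ hUo, hUo⟩ : IsClopen _) (one_mem _) hx
    obtain ⟨u, hu, hug⟩ := hmem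
    have : u⁻¹ * g ∈ N := QuotientGroup.eq.1 hug
    have h2 := U.mul_mem hu (hNU this)
    rwa [mul_inv_cancel_left] at h2
  index_eq U hU hUo := by
    obtain ⟨k, hk⟩ := hG.index_eq (U.comap (QuotientGroup.mk' N)) inferInstance
      (hUo.preimage QuotientGroup.continuous_mk)
    exact ⟨k, by rw [← hk, Subgroup.index_comap_of_surjective _ (QuotientGroup.mk'_surjective N)]⟩

end Quotient

/-! ### Arithmetic of the orientation mod `p^n`. -/

section Orientation

lemma isOpen_toZModPow_eq_one {p : ℕ} [Fact p.Prime] (n : ℕ) :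
    IsOpen {x : ℤ_[p] | PadicInt.toZModPow n x = 1} := by
  have : {x : ℤ_[p] | PadicInt.toZModPow n x = 1} =
      (fun x => x - 1) ⁻¹' Metric.ball 0 ((p : ℝ) ^ (-(n : ℤ) + 1)) := by
    ext x
    rw [Set.mem_ofPred_eq, Set.mem_preimage, mem_ball_zero_iff,
      ← PadicInt.norm_le_pow_iff_norm_lt_pow_add_one,
      PadicInt.norm_le_pow_iff_mem_span_pow, ← PadicInt.ker_toZModPow, RingHom.mem_ker, map_sub,
      map_one, sub_eq_zero]
  rw [this]
  exact Metric.isOpen_ball.preimage (by fun_prop)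

/-- A pro-`p` group acts trivially on `ℤ_p(1)/p`. -/
lemma toZModPow_one_orientation {p : ℕ} [Fact p.Prime] {G : Type u} [Group G]
    [TopologicalSpace G] [IsTopologicalGroup G]
    (hG : IsProP p G) (θ : G →ₜ* ℤ_[p]ˣ) (g : G) :
    PadicInt.toZModPow 1 (θ g : ℤ_[p]) = 1 := by
  let f : G →* (ZMod (p ^ 1))ˣ :=
    (Units.map (PadicInt.toZModPow (p := p) 1 : ℤ_[p] →* ZMod (p ^ 1))).comp (θ : G →* ℤ_[p]ˣ)
  have hf (x : G) : x ∈ f.ker ↔ PadicInt.toZModPow 1 (θ x : ℤ_[p]) = 1 := by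
    rw [MonoidHom.mem_ker, Units.ext_iff]; rfl
  have hopen : IsOpen (f.ker : Set G) := by
    have : (f.ker : Set G) =
        (fun x => ((θ x : ℤ_[p]ˣ) : ℤ_[p])) ⁻¹' {x | PadicInt.toZModPow 1 x = 1} := by
      ext x; exact hf x
    rw [this]
    exact (isOpen_toZModPow_eq_one 1).preimage
      (Units.continuous_val.comp θ.continuous_toFun)
  obtain ⟨k, hk⟩ := hG.index_eq f.ker inferInstance hopen
  have hp : p.Prime := Fact.out
  -- The index of the kernel is a power of `p` and divides the order `p - 1` of `(ℤ/p)ˣ`, hence is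
  -- `1`.
  have hdvd : p ^ k ∣ p - 1 := by
    rw [← hk, Subgroup.index_ker]
    refine (Subgroup.card_subgroup_dvd_card _).trans ?_
    have : NeZero (p ^ 1) := ⟨by simpa using hp.ne_zero⟩
    rw [Nat.card_eq_fintype_card, ZMod.card_units_eq_totient, pow_one, Nat.totient_prime hp]
  have hk0 : k = 0 := by
    by_contra h
    have h1 := Nat.le_of_dvd (by have := hp.two_le; omega) ((dvd_pow_self p h).trans hdvd)
    have := hp.two_le
    omega
  rw [hk0, pow_zero, Subgroup.index_eq_one] at hk
  exact (hf g).1 (hk ▸ Subgroup.mem_top g)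

lemma exists_eq_prime_mul_of_castHom_eq_zero {p n : ℕ} (hn : 1 ≤ n) {z : ZMod (p ^ n)}
    (hz : ZMod.castHom (pow_dvd_pow p hn) (ZMod (p ^ 1)) z = 0) :
    ∃ w, z = (p : ZMod (p ^ n)) * w := by
  obtain ⟨m, rfl⟩ := ZMod.intCast_surjective z
  rw [map_intCast, ZMod.intCast_zmod_eq_zero_iff_dvd, pow_one] at hz
  obtain ⟨w, rfl⟩ := hz
  exact ⟨w, by push_cast; rfl⟩

/-- A quotient by `p^k` in `ℤ/p^n` is unique only mod `p^(n-k)`; as `k < n`, its residue mod `p` is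
well defined. -/
lemma castHom_eq_zero_of_pow_mul_eq_zero {p : ℕ} [Fact p.Prime] {n k : ℕ} (hn : 1 ≤ n)
    (hk : k < n) {z : ZMod (p ^ n)}
    (hz : (p : ZMod (p ^ n)) ^ k * z = 0) :
    ZMod.castHom (pow_dvd_pow p hn) (ZMod (p ^ 1)) z = 0 := by
  obtain ⟨m, rfl⟩ := ZMod.intCast_surjective z
  have hp : p.Prime := Fact.out
  have h : (((p : ℤ) ^ k * m : ℤ) : ZMod (p ^ n)) = 0 := by push_cast; exact hz
  rw [ZMod.intCast_zmod_eq_zero_iff_dvd] at h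
  rw [map_intCast, ZMod.intCast_zmod_eq_zero_iff_dvd]
  push_cast at h ⊢
  have h2 : (p : ℤ) ^ k * (p : ℤ) ^ 1 ∣ (p : ℤ) ^ k * m := by
    rw [← pow_add]; exact (pow_dvd_pow _ hk).trans h
  exact Int.dvd_of_mul_dvd_mul_left (pow_ne_zero _ (by exact_mod_cast hp.ne_zero)) h2

end Orientation

/-! ### The Kummerian property as lifting of homomorphisms. -/

section Cocycle

variable {p : ℕ} [Fact p.Prime] {G : Type u} [Group G] [TopologicalSpace G]

/-- Continuous `1`-cocycles of `G` with values in `ℤ_p(1)/p^n`. -/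
def IsTateCocycle (θ : G →ₜ* ℤ_[p]ˣ) (n : ℕ) (c : G → ZMod (p ^ n)) : Prop :=
  Continuous c ∧ ∀ g h, c (g * h) = c g + PadicInt.toZModPow n (θ g : ℤ_[p]) * c h

variable {θ : G →ₜ* ℤ_[p]ˣ} {n : ℕ} {c d : G → ZMod (p ^ n)}

lemma IsTateCocycle.map_one (hc : IsTateCocycle θ n c) : c 1 = 0 := by
  simpa using hc.2 1 1

lemma IsTateCocycle.conj_apply (hc : IsTateCocycle θ n c) (g : G) {x : G} (hx : θ x = 1) :
    c (g⁻¹ * x * g) = PadicInt.toZModPow n (θ g⁻¹ : ℤ_[p]) * c x := by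
  have h1 := hc.2 g⁻¹ g
  rw [inv_mul_cancel, hc.map_one] at h1
  rw [mul_assoc, hc.2, hc.2 x g, hx]
  simp only [Units.val_one, _root_.map_one, one_mul]
  linear_combination -h1

lemma IsTateCocycle.sub_mul (hc : IsTateCocycle θ n c) (hd : IsTateCocycle θ n d)
    (a : ZMod (p ^ n)) : IsTateCocycle θ n (fun g => c g - a * d g) := by
  refine ⟨hc.1.sub (continuous_const.mul hd.1), fun g h => ?_⟩
  simp only [hc.2 g h, hd.2 g h]
  ring

/-- Every homomorphism `G → ℤ/p` lifts to a cocycle modulo `p^n`. -/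
def LiftsHoms (θ : G →ₜ* ℤ_[p]ˣ) {n : ℕ} (hn : 1 ≤ n) : Prop :=
  ∀ α : G → ZMod (p ^ 1), IsTateCocycle θ 1 α → ∃ c : G → ZMod (p ^ n), IsTateCocycle θ n c ∧
    ∀ g, ZMod.castHom (pow_dvd_pow p hn) (ZMod (p ^ 1)) (c g) = α g

lemma isTateCocycle_iff (c : C(G, tateModule.{u} θ n)) :
    IsTateCocycle θ n (fun g => (show ULift.{u} (ZMod (p ^ n)) from c g).down) ↔
      ContinuousCohomology.IsOneCocycle (tateModule.{u} θ n) c := by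
  constructor
  · intro h x y
    exact ULift.down_injective (h.2 x y)
  · intro h
    exact ⟨continuous_uliftDown.comp c.continuous, fun x y => congrArg ULift.down (h x y)⟩

/-- A cocycle with values in `ℤ_p(1)/p^n` as a continuous map. -/
def IsTateCocycle.toContinuousMap (hc : IsTateCocycle θ n c) : C(G, tateModule.{u} θ n) :=
  ⟨fun g => (ULift.up (c g) : ULift.{u} (ZMod (p ^ n))), continuous_uliftUp.comp hc.1⟩

lemma IsTateCocycle.exists_class [IsTopologicalGroup G] (hc : IsTateCocycle θ n c) :
    ∃ (c' : C(G, tateModule.{u} θ n)) (y : continuousCohomology 1 (tateModule.{u} θ n)),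
      ContinuousCohomology.Represents (tateModule.{u} θ n) c' y ∧
        ∀ g, c' g = (ULift.up (c g) : ULift.{u} (ZMod (p ^ n))) := by
  obtain ⟨y, hy⟩ := ContinuousCohomology.exists_class ((isTateCocycle_iff hc.toContinuousMap).1 hc)
  exact ⟨hc.toContinuousMap, y, hy, fun _ => rfl⟩

lemma isKummerian_of_liftsHoms [IsTopologicalGroup G]
    (h : ∀ (n : ℕ) (hn : 1 ≤ n), LiftsHoms θ hn) : IsKummerian θ := by
  intro n hn y
  obtain ⟨a, ha⟩ := ContinuousCohomology.exists_represents y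
  obtain ⟨c, hc, hca⟩ := h n hn _ ((isTateCocycle_iff a).2 ha.isOneCocycle)
  obtain ⟨c', y', hy', hc'⟩ := hc.exists_class
  have hr := hy'.map (ContinuousMonoidHom.id G) (tateReduction θ hn) (c' := a) fun x => by
    change a x = (tateReduction θ hn).hom (c' x)
    rw [hc']
    exact congrArg ULift.up.{u} (hca x).symm
  exact ⟨y', hr.unique ha⟩

/-- Lifting the class gives `α` only up to a coboundary, which is zero since the action mod `p` is
trivial. -/
lemma IsKummerian.liftsHoms [IsTopologicalGroup G]
    (hθ : ∀ g, PadicInt.toZModPow 1 (θ g : ℤ_[p]) = 1)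
    (h : IsKummerian θ) {n : ℕ} (hn : 1 ≤ n) : LiftsHoms θ hn := by
  intro α hα
  obtain ⟨a, y, hy, ha⟩ := hα.exists_class
  obtain ⟨y', hy'⟩ := h n hn y
  obtain ⟨c, hc⟩ := ContinuousCohomology.exists_represents y'
  have hc' := (isTateCocycle_iff c).2 hc.isOneCocycle
  refine ⟨_, hc', fun g => ?_⟩
  have hr := hc.map (ContinuousMonoidHom.id G) (tateReduction θ hn)
    (c' := ⟨fun x => (tateReduction θ hn).hom (c x),
      (tateReduction θ hn).hom.cont.comp c.continuous⟩) fun x => rfl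
  rw [hy'] at hr
  obtain ⟨v, hv⟩ := hr.exists_coboundary hy
  have h1 := congrArg ULift.down (hv g)
  rw [ha] at h1
  change ZMod.castHom (pow_dvd_pow p hn) (ZMod (p ^ 1)) (ULift.down (c g)) - α g =
    PadicInt.toZModPow 1 (θ g : ℤ_[p]) * ULift.down v - ULift.down v at h1
  rw [hθ, one_mul, sub_self, sub_eq_zero] at h1
  exact h1

end Cocycle

/-! ### Extending invariant homomorphisms from `N` to `G`. -/

section Restriction

variable {p : ℕ} {G : Type u} [Group G] [TopologicalSpace G] [IsTopologicalGroup G]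

lemma exists_extension_of_surjOn (N : Subgroup G) [N.Normal]
    (hres : Set.SurjOn (restriction p N) Set.univ (invariantClasses p N))
    (ψ : N → ZMod p) (hψ : Continuous ψ) (hmul : ∀ x y, ψ (x * y) = ψ x + ψ y)
    (hinv : ∀ (g : G) x, ψ (conj N g x) = ψ x) :
    ∃ β : G → ZMod p, Continuous β ∧ (∀ x y, β (x * y) = β x + β y) ∧ ∀ x : N, β x = ψ x := by
  let c : C(N, trivialModule p N) :=
    ⟨fun g => (ULift.up (ψ g) : ULift.{u} (ZMod p)), continuous_uliftUp.comp hψ⟩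
  obtain ⟨y, hy⟩ := ContinuousCohomology.exists_class
    (show ContinuousCohomology.IsOneCocycle (trivialModule p N) c from
      fun g h => congrArg ULift.up (hmul g h))
  have hyinv : y ∈ invariantClasses p N := fun g =>
    (hy.map (conj N g) (trivialModuleMap p (conj N g)) (c' := c) fun x =>
      congrArg ULift.up (hinv g x).symm).unique hy
  obtain ⟨z, -, hz⟩ := hres hyinv
  obtain ⟨b, hb⟩ := ContinuousCohomology.exists_represents z
  have hr := hb.map (inclusion N) (trivialModuleMap p (inclusion N))
    (c' := b.comp ⟨inclusion N, (inclusion N).continuous_toFun⟩) fun x => rfl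
  change ContinuousCohomology.Represents _ _ (restriction p N z) at hr
  rw [hz] at hr
  obtain ⟨v, hv⟩ := hr.exists_coboundary hy
  refine ⟨fun g => (show ULift.{u} (ZMod p) from b g).down,
    continuous_uliftDown.comp b.continuous,
    fun x y => congrArg ULift.down (hb.isOneCocycle x y), fun x => ?_⟩
  have h1 := congrArg ULift.down (hv x)
  change ULift.down (b x) - ψ x = ULift.down v - ULift.down v at h1
  rwa [sub_self, sub_eq_zero] at h1

end Restriction

/-! ### Making a cocycle vanish on `N`, and descent to `G ⧸ N`. -/

section Descent

variable {p : ℕ} [Fact p.Prime] {G : Type u} [Group G] [TopologicalSpace G]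
  {θ : G →ₜ* ℤ_[p]ˣ} {n : ℕ} {N : Subgroup G} [N.Normal]

/-- A cocycle on `G` vanishing on `N` descends to `G ⧸ N`. -/
lemma IsTateCocycle.exists_descent [IsTopologicalGroup G] (hN : N ≤ (θ : G →* ℤ_[p]ˣ).ker)
    {c : G → ZMod (p ^ n)} (hc : IsTateCocycle θ n c) (h0 : ∀ x ∈ N, c x = 0) :
    ∃ c' : G ⧸ N → ZMod (p ^ n), IsTateCocycle (quotientOrientation θ N hN) n c' ∧
      ∀ g : G, c' g = c g := by
  have hlift : ∀ a b : G, QuotientGroup.leftRel N a b → c a = c b := by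
    intro a b hab
    rw [QuotientGroup.leftRel_apply] at hab
    have h := hc.2 a (a⁻¹ * b)
    rw [h0 _ hab, mul_zero, add_zero, mul_inv_cancel_left] at h
    exact h.symm
  refine ⟨fun x => Quotient.liftOn' x c hlift, ⟨hc.1.quotient_lift hlift, fun x y => ?_⟩,
    fun g => rfl⟩
  obtain ⟨a, rfl⟩ := QuotientGroup.mk_surjective x
  obtain ⟨b, rfl⟩ := QuotientGroup.mk_surjective y
  exact hc.2 a b

/-- If `G`-invariant homomorphisms `N → ℤ/p` extend to `G` and homomorphisms `G → ℤ/p` lift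
modulo `p^n`, then a cocycle whose restriction to `N` is divisible by `p^k` can be modified, without
changing it modulo `p`, so that its restriction to `N` becomes divisible by `p^(k+1)`. -/
lemma IsTateCocycle.exists_divisible_succ (hθ : ∀ g, PadicInt.toZModPow 1 (θ g : ℤ_[p]) = 1)
    (hN : N ≤ (θ : G →* ℤ_[p]ˣ).ker) (hn : 1 ≤ n) (hlift : LiftsHoms θ hn)
    (hext : ∀ ψ : N → ZMod (p ^ 1), Continuous ψ → (∀ x y, ψ (x * y) = ψ x + ψ y) →
      (∀ (g : G) x, ψ (MulAut.conjNormal g⁻¹ x) = ψ x) →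
      ∃ β : G → ZMod (p ^ 1), Continuous β ∧ (∀ x y, β (x * y) = β x + β y) ∧
        ∀ x : N, β x = ψ x)
    {k : ℕ} (hk : 1 ≤ k) (hkn : k < n) {c : G → ZMod (p ^ n)} (hc : IsTateCocycle θ n c)
    (hdvd : ∀ x ∈ N, (p : ZMod (p ^ n)) ^ k ∣ c x) :
    ∃ c' : G → ZMod (p ^ n), IsTateCocycle θ n c' ∧
      (∀ g, ZMod.castHom (pow_dvd_pow p hn) (ZMod (p ^ 1)) (c' g) =
        ZMod.castHom (pow_dvd_pow p hn) (ZMod (p ^ 1)) (c g)) ∧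
      ∀ x ∈ N, (p : ZMod (p ^ n)) ^ (k + 1) ∣ c' x := by
  classical
  set red := ZMod.castHom (pow_dvd_pow p hn) (ZMod (p ^ 1)) with hred
  -- Division by `p^k` followed by reduction mod `p`; the value `0` off the multiples of `p^k` is
  -- never used.
  let F : ZMod (p ^ n) → ZMod (p ^ 1) := fun z =>
    if h : (p : ZMod (p ^ n)) ^ k ∣ z then red h.choose else 0
  have hF (z y : ZMod (p ^ n)) (hz : z = (p : ZMod (p ^ n)) ^ k * y) : F z = red y := by
    have h : (p : ZMod (p ^ n)) ^ k ∣ z := ⟨y, hz⟩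
    simp only [F, dif_pos h]
    rw [← sub_eq_zero, ← map_sub]
    apply castHom_eq_zero_of_pow_mul_eq_zero hn hkn
    rw [mul_sub, ← h.choose_spec, hz, sub_self]
  have hker (x : N) : θ x = 1 := hN x.2
  have hredθ (g : G) : red (PadicInt.toZModPow n (θ g : ℤ_[p])) = 1 := by
    rw [← hθ g]
    exact RingHom.congr_fun (PadicInt.zmod_cast_comp_toZModPow (p := p) 1 n hn) (θ g : ℤ_[p])
  obtain ⟨β, hβc, hβ, hβN⟩ := hext (fun x => F (c x))
    ((continuous_of_discreteTopology (f := F)).comp (hc.1.comp continuous_subtype_val))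
    (fun x y => by
      obtain ⟨a, ha⟩ := hdvd x x.2
      obtain ⟨b, hb⟩ := hdvd y y.2
      rw [hF _ _ ha, hF _ _ hb, ← map_add]
      apply hF
      rw [Subgroup.coe_mul, hc.2, ha, hb, hker]
      simp [mul_add])
    (fun g x => by
      obtain ⟨a, ha⟩ := hdvd x x.2
      have h1 : ((MulAut.conjNormal g⁻¹ x : N) : G) = g⁻¹ * x * g := by
        simp
      rw [h1, hF _ _ ha, hF _ (PadicInt.toZModPow n (θ g⁻¹ : ℤ_[p]) * a), map_mul, hredθ, one_mul]
      rw [hc.conj_apply g (hker x), ha]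
      ring)
  obtain ⟨d, hd, hdβ⟩ := hlift β ⟨hβc, fun g h => by rw [hθ, one_mul, hβ]⟩
  refine ⟨_, hc.sub_mul hd ((p : ZMod (p ^ n)) ^ k), fun g => ?_, fun x hx => ?_⟩
  -- Here `1 ≤ k` matters: the correction `p^k d` dies mod `p`.
  · have hp0 : (p : ZMod (p ^ 1)) = 0 := by
      rw [ZMod.natCast_eq_zero_iff, pow_one]
    rw [map_sub, map_mul, map_pow, map_natCast, hp0, zero_pow (by omega), zero_mul, sub_zero]
  · obtain ⟨y, hy⟩ := hdvd x hx
    have h0 : red (y - d x) = 0 := by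
      rw [map_sub, hred, hdβ, hβN ⟨x, hx⟩, hF _ _ hy, sub_self]
    obtain ⟨w, hw⟩ := exists_eq_prime_mul_of_castHom_eq_zero hn h0
    exact ⟨w, by rw [hy, ← mul_sub, hw, pow_succ, mul_assoc]⟩

/-- Lifting of homomorphisms to cocycles modulo `p^n` passes from `G` to `G ⧸ N`. -/
lemma LiftsHoms.quotient [IsTopologicalGroup G]
    (hθ : ∀ g, PadicInt.toZModPow 1 (θ g : ℤ_[p]) = 1)
    (hN : N ≤ (θ : G →* ℤ_[p]ˣ).ker) (hn : 1 ≤ n) (hlift : LiftsHoms θ hn)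
    (hext : ∀ ψ : N → ZMod (p ^ 1), Continuous ψ → (∀ x y, ψ (x * y) = ψ x + ψ y) →
      (∀ (g : G) x, ψ (MulAut.conjNormal g⁻¹ x) = ψ x) →
      ∃ β : G → ZMod (p ^ 1), Continuous β ∧ (∀ x y, β (x * y) = β x + β y) ∧
        ∀ x : N, β x = ψ x) :
    LiftsHoms (quotientOrientation θ N hN) hn := by
  intro α hα
  have key (k : ℕ) (hk : 1 ≤ k) : k ≤ n → ∃ c : G → ZMod (p ^ n), IsTateCocycle θ n c ∧
      (∀ g : G, ZMod.castHom (pow_dvd_pow p hn) (ZMod (p ^ 1)) (c g) = α g) ∧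
      ∀ x ∈ N, (p : ZMod (p ^ n)) ^ k ∣ c x := by
    induction k, hk using Nat.le_induction with
    | base =>
      intro _
      obtain ⟨c, hc, hcα⟩ := hlift (fun g => α g)
        ⟨hα.1.comp QuotientGroup.continuous_mk, fun g h => hα.2 g h⟩
      refine ⟨c, hc, hcα, fun x hx => ?_⟩
      rw [pow_one]
      apply exists_eq_prime_mul_of_castHom_eq_zero hn
      rw [hcα, (QuotientGroup.eq_one_iff x).2 hx, hα.map_one]
    | succ k hk ih =>
      intro hkn
      obtain ⟨c, hc, hcα, hcN⟩ := ih (by omega)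
      obtain ⟨c', hc', hcc, hcN'⟩ :=
        hc.exists_divisible_succ hθ hN hn hlift hext hk (by omega) hcN
      exact ⟨c', hc', fun g => (hcc g).trans (hcα g), hcN'⟩
  obtain ⟨c, hc, hcα, hcN⟩ := key n hn le_rfl
  obtain ⟨c', hc', hcc⟩ := hc.exists_descent hN fun x hx => by
    have h0 : (p : ZMod (p ^ n)) ^ n = 0 := by rw [← Nat.cast_pow, ZMod.natCast_self]
    simpa [h0] using hcN x hx
  refine ⟨c', hc', fun x => ?_⟩
  obtain ⟨g, rfl⟩ := QuotientGroup.mk_surjective x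
  rw [hcc, hcα]

end Descent

end ProPPair

end

theorem theorem6p6 {p : ℕ} [Fact p.Prime] {G : Type u} [Group G] [TopologicalSpace G]
    [IsTopologicalGroup G] (hG : ProPPair.IsProP p G) (θ : G →ₜ* ℤ_[p]ˣ)
    (hθ : ProPPair.IsTorsionFree θ) (hK : ProPPair.IsKummerian θ)
    (N : Subgroup G) [N.Normal] (hNclosed : IsClosed (N : Set G))
    (hN : N ≤ (θ : G →* ℤ_[p]ˣ).ker) (hfg : ProPPair.IsTopologicallyFG (G ⧸ N))
    (hres : Set.SurjOn (ProPPair.restriction p N) Set.univ (ProPPair.invariantClasses p N)) :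
    ProPPair.IsProP p (G ⧸ N) ∧ ProPPair.IsKummerian (ProPPair.quotientOrientation θ N hN) := by
  refine ⟨hG.quotient N hNclosed, ProPPair.isKummerian_of_liftsHoms fun n hn => ?_⟩
  have hθ1 := ProPPair.toZModPow_one_orientation hG θ
  refine (hK.liftsHoms hθ1 hn).quotient hθ1 hN hn ?_
  rw [pow_one]
  exact ProPPair.exists_extension_of_surjOn N hres
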